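/- **Notation.** All Hilbert spaces are complex and all operators are bounded. The tetrablock is $$\mathbb E=\{(x_1,x_2,x_3)\in\mathbb C^3:\ 1-zx_1-wx_2+zwx_3\neq 0 \text{ whenever } |z|\le 1,\ |w|\le 1\}.$$ An *$\mathbb E$-contraction* is a triple $(T_1,T_2,T_3)$ of commuting operators on a Hilbert space whose Taylor joint spectrum is contained in $\overline{\mathbb E}$ and which satisfies $\|p(T_1,T_2,T_3)\|\le\sup_{x\in\overline{\mathbb E}}|p(x)|$ for every polynomial $p$ in three variables. For a contraction $T$ let $D_T=(I-T^*T)^{1/2}$ and let $\mathcal D_T=\overline{\operatorname{Ran}}\,D_T$. The *fundamental operators* of an $\mathbb E$-contraction $(T_1,T_2,T_3)$ are the unique operators $F_1,F_2$ on $\mathcal D_{T_3}$ such that $$T_1-T_2^*T_3=D_{T_3}F_1D_{T_3},\qquad T_2-T_1^*T_3=D_{T_3}F_2D_{T_3}.$$ Write $[S,T]=ST-TS$, let $\omega(T)=\sup\{|\langle Tx,x\rangle|:\|x\|=1\}$ be the numerical radius, and let $\mathbb T$ be the unit circle. For a Hilbert space $E$ let $H^2(E)\subseteq L^2(\mathbb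 T;E)$ be the space of functions whose Fourier coefficients of negative index vanish, and for $\varphi\in L^\infty(\mathbb T;\mathcal B(E))$ let $T_\varphi f=P(\varphi f)$, $f\in H^2(E)$, be the Toeplitz operator with symbol $\varphi$, where $P$ is the orthogonal projection of $L^2(\mathbb T;E)$ onto $H^2(E)$. **Corollary 3.6.** Let $A_1,A_2$ be commuting operators on a Hilbert space $E$ such that $[A_1^*,A_1]=[A_2^*,A_2]$ and $\omega(A_1+A_2z)\le 1$ for all $z\in\mathbb T$. Then $$\bigl(T_{A_1^*+A_2z}^*,\ T_{A_2^*+A_1z}^*,\ T_z^*\bigr)$$ is an $\mathbb E$-contraction on $H^2(E)$, and $A_1,A_2$ are its fundamental operators, where $E$ is identified with $\mathcal D_{T_z^*}$ as follows: $\mathcal D_{T_z^*}$ is the space of constant functions in $H^2(E)$, the map $U:E\to\mathcal D_{T_z^*}$ sending $x\in E$ to the constant function with value $x$ is unitary, and the fundamental operators are $UA_1U^{-1}$ and $UA_2U^{-1}$. -/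

import Mathlib

open MeasureTheory ContinuousLinearMap
open scoped ENNReal

noncomputable section

/-! ### The tetrablock -/

/-- The tetrablock `𝔼 ⊆ ℂ³`. -/
def tetrablock : Set (Fin 3 → ℂ) :=
  {x | ∀ z w : ℂ, ‖z‖ ≤ 1 → ‖w‖ ≤ 1 → 1 - z * x 0 - w * x 1 + z * w * x 2 ≠ 0}

/-! ### Operator theory -/

section Operators

variable {H : Type*} [NormedAddCommGroup H] [InnerProductSpace ℂ H]

/-- The numerical radius `ω(T) = sup {|⟨T x, x⟩| : ‖x‖ = 1}` of a bounded operator. The set is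
bounded above by `‖T‖`; for `H = 0` it is empty and the value is `0`. -/
def numericalRadius (T : H →L[ℂ] H) : ℝ :=
  sSup {r : ℝ | ∃ x : H, ‖x‖ = 1 ∧ r = ‖inner ℂ (T x) x‖}

/-- First map `X → X³` of the Koszul complex of a triple of operators. -/
def koszul₁ (T : Fin 3 → H →L[ℂ] H) (x : H) : H × H × H :=
  (T 0 x, T 1 x, T 2 x)

/-- Second map `X³ → X³` of the Koszul complex; the coordinates of the target are ordered as
`e₀ ∧ e₁`, `e₀ ∧ e₂`, `e₁ ∧ e₂`. -/
def koszul₂ (T : Fin 3 → H →L[ℂ] H) (x : H × H × H) : H × H × H :=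
  (T 0 x.2.1 - T 1 x.1, T 0 x.2.2 - T 2 x.1, T 1 x.2.2 - T 2 x.2.1)

/-- Third map `X³ → X` of the Koszul complex. -/
def koszul₃ (T : Fin 3 → H →L[ℂ] H) (y : H × H × H) : H :=
  T 0 y.2.2 - T 1 y.2.1 + T 2 y.1

/-- A triple is Taylor regular if its Koszul complex `0 → X → X³ → X³ → X → 0` is exact. -/
def TaylorRegular (T : Fin 3 → H →L[ℂ] H) : Prop :=
  Function.Injective (koszul₁ T) ∧ Function.Exact (koszul₁ T) (koszul₂ T) ∧
    Function.Exact (koszul₂ T) (koszul₃ T) ∧ Function.Surjective (koszul₃ T)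

/-- The Taylor joint spectrum of a commuting triple. -/
def taylorSpectrum (T : Fin 3 → H →L[ℂ] H) : Set (Fin 3 → ℂ) :=
  {l | ¬ TaylorRegular (fun i => T i - l i • (1 : H →L[ℂ] H))}

/-- The operator `p(T₁, T₂, T₃)` for a polynomial `p` in three variables. (For commuting operators
the order of the factors does not matter.) -/
def polyEval (p : MvPolynomial (Fin 3) ℂ) (T : Fin 3 → H →L[ℂ] H) : H →L[ℂ] H :=
  ∑ m ∈ p.support, p.coeff m • (T 0 ^ m 0 * T 1 ^ m 1 * T 2 ^ m 2)

/-- `𝔼`-contractions: commuting triples having the closed tetrablock as a spectral set. The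
supremum is taken in `[0, ∞]`. -/
structure IsEContraction (T : Fin 3 → H →L[ℂ] H) : Prop where
  commute : ∀ i j, Commute (T i) (T j)
  spectrum_subset : taylorSpectrum T ⊆ closure tetrablock
  norm_le : ∀ p : MvPolynomial (Fin 3) ℂ,
    ‖polyEval p T‖ₑ ≤ ⨆ x ∈ closure tetrablock, ‖MvPolynomial.eval x p‖ₑ

variable [CompleteSpace H]

/-- The defect operator `D_T = (I - T* T)^{1/2}` of a contraction `T` (positive square root). -/
def defectOp (T : H →L[ℂ] H) : H →L[ℂ] H :=
  CFC.sqrt (1 - adjoint T * T)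

/-- The defect space `𝒟_T`, the closure of the range of `D_T`. -/
def defectSpace (T : H →L[ℂ] H) : Submodule ℂ H :=
  (LinearMap.range (defectOp T : H →ₗ[ℂ] H)).topologicalClosure

theorem defectOp_mem (T : H →L[ℂ] H) (x : H) : defectOp T x ∈ defectSpace T :=
  Submodule.le_topologicalClosure _ ⟨x, rfl⟩

/-- The operator `D_T F D_T` on `H`, for an operator `F` on the defect space `𝒟_T`. -/
def defectSandwich (T : H →L[ℂ] H) (F : defectSpace T →L[ℂ] defectSpace T) : H →L[ℂ] H :=
  defectOp T ∘L (defectSpace T).subtypeL ∘L F ∘L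
    (defectOp T).codRestrict (defectSpace T) (defectOp_mem T)

/-- The equations `T₁ - T₂* T₃ = D F₁ D` and `T₂ - T₁* T₃ = D F₂ D`, where `D = D_{T₃}`. -/
def FundamentalEquations (T : Fin 3 → H →L[ℂ] H)
    (F₁ F₂ : defectSpace (T 2) →L[ℂ] defectSpace (T 2)) : Prop :=
  T 0 - adjoint (T 1) * T 2 = defectSandwich (T 2) F₁ ∧
    T 1 - adjoint (T 0) * T 2 = defectSandwich (T 2) F₂

/-- `F₁, F₂` are the fundamental operators of the triple `T`: the unique operators on `𝒟_{T₃}`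
which solve the fundamental equations. -/
def AreFundamentalOperators (T : Fin 3 → H →L[ℂ] H)
    (F₁ F₂ : defectSpace (T 2) →L[ℂ] defectSpace (T 2)) : Prop :=
  FundamentalEquations T F₁ F₂ ∧
    ∀ G₁ G₂ : defectSpace (T 2) →L[ℂ] defectSpace (T 2),
      FundamentalEquations T G₁ G₂ → G₁ = F₁ ∧ G₂ = F₂

end Operators

/-! ### The vectorial Hardy space and Toeplitz operators

The unit circle is parametrized by `UnitAddCircle = ℝ / ℤ`, with normalized Haar measure; the
coordinate `z = exp (2 π i t)` is the function `fourier 1`. -/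

section Hardy

variable (E : Type*) [NormedAddCommGroup E] [InnerProductSpace ℂ E]

/-- The space `L²(𝕋; E)`. -/
abbrev L2Circle : Type _ :=
  Lp E 2 (AddCircle.haarAddCircle : Measure UnitAddCircle)

variable {E} [CompleteSpace E]

theorem fourierCoeff_eq_lpPairing (n : ℤ) (f : L2Circle E) :
    fourierCoeff (f : UnitAddCircle → E) n =
      (ContinuousLinearMap.lsmul ℂ ℂ : ℂ →L[ℂ] E →L[ℂ] E).lpPairing
        (AddCircle.haarAddCircle : Measure UnitAddCircle) 2 2 (fourierLp 2 (-n)) f := by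
  rw [ContinuousLinearMap.lpPairing_eq_integral]
  refine integral_congr_ae ?_
  filter_upwards [coeFn_fourierLp (T := 1) 2 (-n)] with t ht
  rw [ht, ContinuousLinearMap.lsmul_apply]

variable (E) in
/-- The Hardy space `H²(E)`: the functions in `L²(𝕋; E)` whose Fourier coefficients of negative
index vanish. -/
def H2 : Submodule ℂ (L2Circle E) where
  carrier := {f | ∀ n : ℤ, n < 0 → fourierCoeff (f : UnitAddCircle → E) n = 0}
  add_mem' := by
    intro f g hf hg n hn
    have h1 := hf n hn
    have h2 := hg n hn
    rw [fourierCoeff_eq_lpPairing] at h1 h2 ⊢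
    rw [map_add, h1, h2, add_zero]
  zero_mem' := by
    intro n _
    rw [fourierCoeff_eq_lpPairing, map_zero]
  smul_mem' := by
    intro c f hf n hn
    have h1 := hf n hn
    rw [fourierCoeff_eq_lpPairing] at h1 ⊢
    rw [map_smul, h1, smul_zero]

theorem isClosed_H2 : IsClosed (H2 E : Set (L2Circle E)) := by
  have h : (H2 E : Set (L2Circle E)) =
      ⋂ n : ℤ, ⋂ _ : n < 0, {f : L2Circle E | fourierCoeff (f : UnitAddCircle → E) n = 0} := by
    ext f
    simp [H2]
  rw [h]
  refine isClosed_iInter fun n => isClosed_iInter fun _ => ?_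
  simp only [fourierCoeff_eq_lpPairing]
  exact isClosed_eq (ContinuousLinearMap.continuous _) continuous_const

instance : CompleteSpace (H2 E) :=
  isClosed_H2.completeSpace_coe

/-- The multiplication operator `M_φ` on `L²(𝕋; E)` with symbol `φ ∈ L^∞(𝕋; B(E))`,
`(M_φ f)(z) = φ(z) f(z)`. -/
def mulOp (φ : Lp (E →L[ℂ] E) ∞ (AddCircle.haarAddCircle : Measure UnitAddCircle)) :
    L2Circle E →L[ℂ] L2Circle E :=
  (ContinuousLinearMap.id ℂ (E →L[ℂ] E)).holderL
    (AddCircle.haarAddCircle : Measure UnitAddCircle) ∞ 2 2 φ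

/-- The Toeplitz operator `T_φ = P M_φ` on `H²(E)` with symbol `φ ∈ L^∞(𝕋; B(E))`, where `P` is
the orthogonal projection of `L²(𝕋; E)` onto `H²(E)`. -/
def toeplitz (φ : Lp (E →L[ℂ] E) ∞ (AddCircle.haarAddCircle : Measure UnitAddCircle)) :
    H2 E →L[ℂ] H2 E :=
  (H2 E).orthogonalProjectionOnto ∘L mulOp φ ∘L (H2 E).subtypeL

/-- The symbol `z ↦ B + z C` for operators `B, C` on `E`. -/
def affineSymbol (B C : E →L[ℂ] E) :
    Lp (E →L[ℂ] E) ∞ (AddCircle.haarAddCircle : Measure UnitAddCircle) :=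
  ContinuousMap.toLp ∞ AddCircle.haarAddCircle ℂ
    (⟨fun t => B + (fourier 1 t : ℂ) • C, by fun_prop⟩ : C(UnitAddCircle, E →L[ℂ] E))

/-- The triple `(T_{A₁* + A₂ z}*, T_{A₂* + A₁ z}*, T_z*)` on `H²(E)`. -/
def adjointToeplitzTriple (A₁ A₂ : E →L[ℂ] E) : Fin 3 → H2 E →L[ℂ] H2 E :=
  ![adjoint (toeplitz (affineSymbol (adjoint A₁) A₂)),
    adjoint (toeplitz (affineSymbol (adjoint A₂) A₁)),
    adjoint (toeplitz (affineSymbol 0 1))]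

end Hardy

end

/-! On the circle put `N(z) = A₁* + z A₂`. Since `N(z)* z = A₂* + z A₁`, the three symbols are `N`,
`z N*` and `z`. Commutativity and equality of the self-commutators say exactly what makes `N(z)`
normal. Choosing the phase in the numerical radius bound gives `|⟨A₁x, x⟩| + |⟨A₂x, x⟩| ≤ ‖x‖²`, so
`N(z)` has numerical radius at most 1 and, being normal, is a contraction
(`norm_symbolTriple_zero_le`).

For fixed `ζ = z` the triple `(N, ζ N*, ζ)` is a continuous function of the normal contraction `N`,
and the points `(l, ζ l̄, ζ)` with `|l| ≤ 1` lie in the closed tetrablock; this gives the polynomial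
inequality pointwise (`norm_polyEval_le`). Analytic Toeplitz operators multiply pointwise
(`ActsBy`), so identities and norm bounds pass to `H²(E)`, and then to adjoints. The Taylor spectrum
is controlled by inverting `1 - z T₁ - w T₂ + z w T₃` on the open bidisc.

With `J` the inclusion of constants, `1 - T_z T_z* = J J*` is a projection, hence its own square
root. Writing `V₁, V₂` for the first two analytic Toeplitz operators, `V₁* T_z = V₂` gives `V₁* - V₂
T_z* = V₁* J J* = J A₁ J*`, and symmetrically for `A₂`. -/

noncomputable section

/-! ### Points of the closed tetrablock -/

section Tetrablock

/-- The difference of the squares is `(1 - |a|²)(1 - |l|²)`. -/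
theorem norm_sub_conj_le {a l : ℂ} (ha : ‖a‖ ≤ 1) (hl : ‖l‖ ≤ 1) :
    ‖a - star l‖ ≤ ‖1 - a * l‖ := by
  have h1 : ‖a‖ ^ 2 ≤ 1 := by nlinarith [norm_nonneg a]
  have h2 : ‖l‖ ^ 2 ≤ 1 := by nlinarith [norm_nonneg l]
  rw [← sq_le_sq₀ (norm_nonneg _) (norm_nonneg _)]
  simp only [Complex.sq_norm, Complex.normSq_apply] at *
  simp
  nlinarith [mul_nonneg (sub_nonneg.2 h1) (sub_nonneg.2 h2)]

/-- The dilates `(r x₀, r x₁, r² x₂)`, `r < 1`, trade the open bidisc for the closed one; let `r →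
1`. -/
theorem mem_closure_tetrablock_of_forall_lt {x : Fin 3 → ℂ}
    (h : ∀ z w : ℂ, ‖z‖ < 1 → ‖w‖ < 1 → 1 - z * x 0 - w * x 1 + z * w * x 2 ≠ 0) :
    x ∈ closure tetrablock := by
  let g : ℝ → Fin 3 → ℂ := fun r => ![r * x 0, r * x 1, r ^ 2 * x 2]
  have hg : Continuous g := by
    refine continuous_pi fun i => ?_
    fin_cases i <;> simp [g] <;> fun_prop
  have h1 : g 1 = x := by
    ext i
    fin_cases i <;> simp [g]
  have hm : ∀ r ∈ Set.Ico (0 : ℝ) 1, g r ∈ tetrablock := by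
    intro r hr z w hz hw
    have key : ∀ u : ℂ, ‖u‖ ≤ 1 → ‖(r : ℂ) * u‖ < 1 := by
      intro u hu
      rw [norm_mul, Complex.norm_real, Real.norm_of_nonneg hr.1]
      nlinarith [hr.1, hr.2, norm_nonneg u]
    have := h (r * z) (r * w) (key z hz) (key w hw)
    convert this using 1
    simp [g]
    ring
  have hc : (1 : ℝ) ∈ closure (Set.Ico (0 : ℝ) 1) := by
    rw [closure_Ico zero_ne_one]
    simp
  rw [← h1]
  exact map_mem_closure hg hc hm

/-- A zero would give `1 - z l = w ζ (l̄ - z)`, which `|w| < 1` and `norm_sub_conj_le` forbid. -/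
theorem mem_closure_tetrablock_of_norm_le {l ζ : ℂ} (hl : ‖l‖ ≤ 1) (hζ : ‖ζ‖ = 1) :
    ![l, ζ * star l, ζ] ∈ closure tetrablock := by
  refine mem_closure_tetrablock_of_forall_lt fun z w hz hw h0 => ?_
  simp only [Matrix.cons_val] at h0
  have h1 : 1 - z * l = w * ζ * (star l - z) := by linear_combination h0
  have h2 : ‖1 - z * l‖ = ‖w‖ * ‖z - star l‖ := by
    rw [h1, norm_mul, norm_mul, hζ, mul_one, norm_sub_rev]
  have h3 := norm_sub_conj_le hz.le hl
  have h4 : 0 < ‖1 - z * l‖ := by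
    rw [norm_pos_iff, sub_ne_zero]
    intro h
    have : ‖z * l‖ = 1 := by rw [← h, norm_one]
    rw [norm_mul] at this
    nlinarith [norm_nonneg z, norm_nonneg l]
  nlinarith [norm_nonneg w]

end Tetrablock

/-! ### Koszul complex and Taylor spectrum -/

section Koszul

variable {H : Type*} [NormedAddCommGroup H] [InnerProductSpace ℂ H]

/-- The `S i` define a contracting homotopy of the Koszul complex; every preimage below is read off
from it. -/
theorem taylorRegular_of_sum_mul_eq_one {T S : Fin 3 → H →L[ℂ] H}
    (hT : ∀ i j, Commute (T i) (T j)) (hS : ∀ i j, Commute (S i) (T j))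
    (h1 : T 0 * S 0 + T 1 * S 1 + T 2 * S 2 = 1) : TaylorRegular T := by
  have cT : ∀ i j x, T i (T j x) = T j (T i x) := fun i j x => congr($(hT i j) x)
  have cS : ∀ i j x, T j (S i x) = S i (T j x) := fun i j x => congr($((hS i j).symm) x)
  have hsum : ∀ x, S 0 (T 0 x) + S 1 (T 1 x) + S 2 (T 2 x) = x := fun x => by
    simpa [cS] using congr($h1 x)
  refine ⟨?_, ?_, ?_, ?_⟩
  · intro x y hxy
    simp only [koszul₁, Prod.mk.injEq] at hxy
    rw [← hsum x, ← hsum y, hxy.1, hxy.2.1, hxy.2.2]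
  · rintro ⟨a, b, c⟩
    simp only [koszul₁, koszul₂, Set.mem_range, Prod.mk.injEq, Prod.mk_eq_zero, sub_eq_zero]
    constructor
    · rintro ⟨h01, h02, h12⟩
      refine ⟨S 0 a + S 1 b + S 2 c, ?_, ?_, ?_⟩
      · simp only [map_add, cS, h01, h02]
        exact hsum a
      · simp only [map_add, cS, ← h01, h12]
        exact hsum b
      · simp only [map_add, cS, ← h02, ← h12]
        exact hsum c
    · rintro ⟨x, rfl, rfl, rfl⟩
      exact ⟨cT _ _ _, cT _ _ _, cT _ _ _⟩
  · rintro ⟨a, b, c⟩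
    simp only [koszul₂, koszul₃, Set.mem_range, Prod.mk.injEq, Prod.exists]
    constructor
    · intro h
      refine ⟨-(S 1 a) - S 2 b, S 0 a - S 2 c, S 0 b + S 1 c, ?_, ?_, ?_⟩
      · have h' : S 2 (T 0 c) - S 2 (T 1 b) + S 2 (T 2 a) = 0 := by
          rw [← map_sub, ← map_add, h, map_zero]
        simp only [map_sub, map_neg, cS]
        linear_combination (norm := module) hsum a - h'
      · have h' : S 1 (T 0 c) - S 1 (T 1 b) + S 1 (T 2 a) = 0 := by
          rw [← map_sub, ← map_add, h, map_zero]
        simp only [map_add, map_sub, map_neg, cS]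
        linear_combination (norm := module) hsum b + h'
      · have h' : S 0 (T 0 c) - S 0 (T 1 b) + S 0 (T 2 a) = 0 := by
          rw [← map_sub, ← map_add, h, map_zero]
        simp only [map_add, map_sub, cS]
        linear_combination (norm := module) hsum c - h'
    · rintro ⟨x, y, z, rfl, rfl, rfl⟩
      simp only [map_sub, cT 1 0, cT 2 0, cT 2 1]
      abel
  · intro y
    refine ⟨(S 2 y, -(S 1 y), S 0 y), ?_⟩
    simp only [koszul₃, map_neg, cS]
    linear_combination (norm := module) hsum y

/-- If the form vanishes at `l`, its value at `T` is a combination of the `T i - l i`; multiplying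
by the inverse exhibits 1 in the ideal they generate. -/
theorem taylorSpectrum_subset_closure_tetrablock {T : Fin 3 → H →L[ℂ] H}
    (hT : ∀ i j, Commute (T i) (T j))
    (h : ∀ z w : ℂ, ‖z‖ < 1 → ‖w‖ < 1 →
      IsUnit (1 - z • T 0 - w • T 1 + (z * w) • T 2)) :
    taylorSpectrum T ⊆ closure tetrablock := by
  intro l hl
  refine mem_closure_tetrablock_of_forall_lt fun z w hz hw h0 => hl ?_
  obtain ⟨u, hu⟩ := h z w hz hw
  have huT : ∀ j, Commute (↑u⁻¹ : H →L[ℂ] H) (T j) := by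
    intro j
    refine Commute.units_inv_left ?_
    rw [hu]
    exact (((Commute.one_left _).sub_left ((hT 0 j).smul_left z)).sub_left
      ((hT 1 j).smul_left w)).add_left ((hT 2 j).smul_left (z * w))
  have hinv : (1 - z • T 0 - w • T 1 + (z * w) • T 2) * ↑u⁻¹ = 1 := by
    rw [← hu, Units.mul_inv]
  refine taylorRegular_of_sum_mul_eq_one
    (S := ![(-z) • (↑u⁻¹ : H →L[ℂ] H), (-w) • (↑u⁻¹ : H →L[ℂ] H),
      (z * w) • (↑u⁻¹ : H →L[ℂ] H)]) ?_ ?_ ?_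
  · intro i j
    exact ((hT i j).sub_right ((Commute.one_right _).smul_right _)).sub_left
      (((Commute.one_left _).smul_left _))
  · have key : ∀ (c : ℂ) (j : Fin 3),
        Commute (c • (↑u⁻¹ : H →L[ℂ] H)) (T j - l j • 1) := fun c j =>
      ((huT j).sub_right ((Commute.one_right _).smul_right _)).smul_left c
    intro i j
    fin_cases i <;> exact key _ j
  · have e : (1 : H →L[ℂ] H) - z • T 0 - w • T 1 + (z * w) • T 2 =
        (-z) • (T 0 - l 0 • 1) + (-w) • (T 1 - l 1 • 1) + (z * w) • (T 2 - l 2 • 1) := by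
      have h0' : (1 - z * l 0 - w * l 1 + z * w * l 2) • (1 : H →L[ℂ] H) = 0 := by
        rw [h0, zero_smul]
      linear_combination (norm := module) h0'
    rw [e] at hinv
    simpa [add_mul] using hinv

end Koszul

/-! ### Normal contractions and numerical radius -/

section Normal

variable {H : Type*} [NormedAddCommGroup H] [InnerProductSpace ℂ H]

theorem norm_inner_le_of_numericalRadius_le {T : H →L[ℂ] H} {c : ℝ}
    (h : numericalRadius T ≤ c) (x : H) : ‖inner ℂ (T x) x‖ ≤ c * ‖x‖ ^ 2 := by
  rcases eq_or_ne x 0 with rfl | hx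
  · simp
  have hx' : ‖x‖ ≠ 0 := norm_ne_zero_iff.2 hx
  have hb : BddAbove {r : ℝ | ∃ x : H, ‖x‖ = 1 ∧ r = ‖inner ℂ (T x) x‖} := by
    refine ⟨‖T‖, ?_⟩
    rintro r ⟨y, hy, rfl⟩
    calc ‖inner ℂ (T y) y‖ ≤ ‖T y‖ * ‖y‖ := norm_inner_le_norm _ _
      _ ≤ ‖T‖ := by rw [hy, mul_one]; simpa [hy] using T.le_opNorm y
  have h1 : ‖inner ℂ (T ((‖x‖⁻¹ : ℂ) • x)) ((‖x‖⁻¹ : ℂ) • x)‖ ≤ c :=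
    (le_csSup hb ⟨_, by simp [norm_smul, hx'], rfl⟩).trans h
  rw [map_smul, inner_smul_left, inner_smul_right] at h1
  simp only [norm_mul, RCLike.norm_conj, norm_inv, Complex.norm_real, norm_norm] at h1
  field_simp at h1
  linarith

variable [CompleteSpace H]

/-- For `|l| > c` the form of `l - T` is bounded below by `(|l| - c)‖x‖²`, so `l` is not in the
spectrum; for normal `T` the spectral radius is the norm. -/
theorem norm_le_of_norm_inner_le {T : H →L[ℂ] H} [hT : IsStarNormal T] {c : ℝ} (hc : 0 ≤ c)
    (h : ∀ x, ‖inner ℂ (T x) x‖ ≤ c * ‖x‖ ^ 2) : ‖T‖ ≤ c := by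
  have hs : ∀ l ∈ spectrum ℂ T, ‖l‖ ≤ c := by
    intro l hl
    by_contra! hlc
    refine hl ?_
    refine isUnit_of_forall_le_norm_inner_map _ (c := ⟨‖l‖ - c, (sub_pos.2 hlc).le⟩)
      (by exact sub_pos.2 hlc) fun x => ?_
    have e : inner ℂ ((algebraMap ℂ (H →L[ℂ] H) l - T) x) x =
        inner ℂ (l • x) x - inner ℂ (T x) x := by
      rw [← inner_sub_left, Algebra.algebraMap_eq_smul_one]
      rfl
    calc ‖x‖ ^ 2 * (‖l‖ - c) = ‖inner ℂ (l • x) x‖ - c * ‖x‖ ^ 2 := by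
          rw [inner_smul_left, norm_mul, inner_self_eq_norm_sq_to_K]
          simp
          ring
      _ ≤ ‖inner ℂ (l • x) x‖ - ‖inner ℂ (T x) x‖ := by linarith [h x]
      _ ≤ ‖inner ℂ ((algebraMap ℂ (H →L[ℂ] H) l - T) x) x‖ := by
          rw [e]
          exact norm_sub_norm_le _ _
  have hr : spectralRadius ℂ T ≤ ENNReal.ofReal c := by
    refine iSup₂_le fun l hl => ?_
    rw [← enorm_eq_nnnorm, ← ofReal_norm]
    exact ENNReal.ofReal_le_ofReal (hs l hl)
  rw [IsStarNormal.spectralRadius_eq_nnnorm, ← enorm_eq_nnnorm, ← ofReal_norm,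
    ENNReal.ofReal_le_ofReal_iff hc] at hr
  exact hr

/-- Operator form of `norm_sub_conj_le`: normality replaces the left side by `‖N x - z̄ x‖`, and the
squares then differ by `(‖x‖² - ‖N x‖²)(1 - |z|²)`. -/
theorem norm_adjoint_sub_smul_le {N : H →L[ℂ] H} [hN : IsStarNormal N] (h : ‖N‖ ≤ 1) {z : ℂ}
    (hz : ‖z‖ ≤ 1) (x : H) : ‖adjoint N x - z • x‖ ≤ ‖x - z • N x‖ := by
  have hn : IsStarNormal (N - (star z) • 1) := by
    constructor
    simp only [star_sub, star_smul, star_one, star_star]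
    exact (hN.star_comm_self.sub_right ((Commute.one_right _).smul_right _)).sub_left
      ((Commute.one_left _).smul_left _)
  have e : ‖adjoint N x - z • x‖ = ‖N x - star z • x‖ := by
    have := isStarNormal_iff_norm_eq_adjoint.1 hn x
    rw [← star_eq_adjoint, star_sub, star_smul, star_one, star_star, star_eq_adjoint] at this
    simpa using this.symm
  have hNx : ‖N x‖ ^ 2 ≤ ‖x‖ ^ 2 := by
    have := N.le_of_opNorm_le h x
    gcongr
    linarith
  have hz2 : ‖z‖ ^ 2 ≤ 1 := by nlinarith [norm_nonneg z]
  rw [e, ← sq_le_sq₀ (norm_nonneg _) (norm_nonneg _), @norm_sub_sq ℂ, @norm_sub_sq ℂ,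
    inner_smul_right, inner_smul_right, ← inner_conj_symm (N x) x, norm_smul, norm_smul, norm_star]
  have e2 : RCLike.re (star z * (starRingEnd ℂ) (inner ℂ x (N x))) =
      RCLike.re (z * inner ℂ x (N x)) := by
    rw [← RCLike.conj_re (z * inner ℂ x (N x)), map_mul (starRingEnd ℂ)]
    rfl
  rw [e2]
  nlinarith [mul_nonneg (sub_nonneg.2 hNx) (sub_nonneg.2 hz2)]

/-- With `R = 1 - z V₀` and `G = V₁ - z V₂` the operator is `(1 - w G R⁻¹) R`; the hypothesis says
`‖G R⁻¹‖ ≤ 1`, so both factors are Neumann-invertible. -/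
theorem isUnit_one_sub_sub_add {V : Fin 3 → H →L[ℂ] H} (h0 : ‖V 0‖ ≤ 1)
    (h : ∀ (z : ℂ) (x : H), ‖z‖ < 1 → ‖V 1 x - z • V 2 x‖ ≤ ‖x - z • V 0 x‖) {z w : ℂ}
    (hz : ‖z‖ < 1) (hw : ‖w‖ < 1) :
    IsUnit (1 - z • V 0 - w • V 1 + (z * w) • V 2) := by
  have hR : ‖z • V 0‖ < 1 := by
    rw [norm_smul]
    nlinarith [norm_nonneg z, norm_nonneg (V 0)]
  obtain ⟨u, hu⟩ := isUnit_one_sub_of_norm_lt_one hR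
  set G := V 1 - z • V 2 with hG
  have hGu : ‖G * ↑u⁻¹‖ ≤ 1 := by
    refine opNorm_le_bound _ zero_le_one fun y => ?_
    have h1 := h z ((↑u⁻¹ : H →L[ℂ] H) y) hz
    have h2 : (1 - z • V 0) ((↑u⁻¹ : H →L[ℂ] H) y) = y := by
      rw [← hu]
      exact congr($(u.mul_inv) y)
    have h3 : (↑u⁻¹ : H →L[ℂ] H) y - z • V 0 ((↑u⁻¹ : H →L[ℂ] H) y) = y := h2
    rw [h3] at h1
    simpa [hG] using h1
  have h3 : IsUnit (1 - w • (G * ↑u⁻¹)) := by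
    refine isUnit_one_sub_of_norm_lt_one ?_
    rw [norm_smul]
    nlinarith [norm_nonneg w, norm_nonneg (G * (↑u⁻¹ : H →L[ℂ] H))]
  have e : 1 - z • V 0 - w • V 1 + (z * w) • V 2 = (1 - w • (G * ↑u⁻¹)) * ↑u := by
    rw [sub_mul, one_mul, smul_mul_assoc, mul_assoc, Units.inv_mul, mul_one, hu, hG]
    simp only [smul_sub, smul_smul, mul_comm z w]
    abel
  rw [e]
  exact h3.mul u.isUnit

theorem norm_polyEval_le {N : H →L[ℂ] H} [hN : IsStarNormal N] (h : ‖N‖ ≤ 1) {ζ : ℂ}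
    (hζ : ‖ζ‖ = 1) {p : MvPolynomial (Fin 3) ℂ} {c : ℝ} (hc : 0 ≤ c)
    (hp : ∀ x ∈ closure tetrablock, ‖MvPolynomial.eval x p‖ ≤ c) :
    ‖polyEval p ![N, ζ • star N, ζ • 1]‖ ≤ c := by
  have e : polyEval p ![N, ζ • star N, ζ • 1] =
      cfc (fun l : ℂ => MvPolynomial.eval ![l, ζ * star l, ζ] p) N := by
    simp only [MvPolynomial.eval_eq', Fin.prod_univ_three, Matrix.cons_val]
    have hs : (fun l : ℂ => ∑ m ∈ p.support,
        p.coeff m * (l ^ m 0 * (ζ * star l) ^ m 1 * ζ ^ m 2)) =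
        ∑ m ∈ p.support, fun l : ℂ => p.coeff m * (l ^ m 0 * (ζ * star l) ^ m 1 * ζ ^ m 2) := by
      ext l
      simp
    rw [hs, cfc_sum _ _ _ (fun m _ => by fun_prop), polyEval]
    refine Finset.sum_congr rfl fun m _ => ?_
    rw [cfc_const_mul _ _ _ (by fun_prop), cfc_mul _ _ _ (by fun_prop) (by fun_prop),
      cfc_mul _ _ _ (by fun_prop) (by fun_prop), cfc_pow _ _ _ (by fun_prop),
      cfc_pow _ _ _ (by fun_prop), cfc_const_mul _ _ _ (by fun_prop), cfc_star_id N hN, cfc_id' ℂ N hN,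
      cfc_const (ζ ^ m 2) N hN]
    simp [Algebra.algebraMap_eq_smul_one, smul_pow]
  rw [e]
  refine norm_cfc_le hc fun l hl => hp _ (mem_closure_tetrablock_of_norm_le ?_ hζ)
  -- The spectral bound by the norm needs `‖1‖ = 1`, which fails on the zero space.
  rcases subsingleton_or_nontrivial H with hH | hH
  · have : Subsingleton (H →L[ℂ] H) := inferInstance
    simp [spectrum.of_subsingleton] at hl
  · exact (spectrum.norm_le_norm_of_mem hl).trans h

end Normal

/-! ### Pointwise calculus for analytic Toeplitz operators -/

section HardyCalculus

variable {E : Type*} [NormedAddCommGroup E] [InnerProductSpace ℂ E] [CompleteSpace E]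

omit [InnerProductSpace ℂ E] [CompleteSpace E] in
theorem integrable_L2Circle (f : L2Circle E) :
    Integrable (f : UnitAddCircle → E) AddCircle.haarAddCircle :=
  (Lp.memLp f).integrable one_le_two

theorem fourier_neg_mul_fourier_one (n : ℤ) (t : UnitAddCircle) :
    (fourier (-n) t : ℂ) * fourier 1 t = fourier (-(n - 1)) t := by
  rw [← fourier_add]
  congr 2
  ring

theorem norm_fourier_apply (n : ℤ) (t : UnitAddCircle) : ‖(fourier n t : ℂ)‖ = 1 :=
  Circle.norm_coe _

theorem star_fourier_one_mul (t : UnitAddCircle) :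
    star (fourier 1 t : ℂ) * fourier 1 t = 1 := by
  have := Complex.conj_mul' (fourier 1 t : ℂ)
  rw [norm_fourier_apply] at this
  simpa using this

theorem fourierCoeff_affine (B C : E →L[ℂ] E) {f : UnitAddCircle → E}
    (hf : Integrable f AddCircle.haarAddCircle) (n : ℤ) :
    fourierCoeff (fun t => B (f t) + (fourier 1 t : ℂ) • C (f t)) n =
      B (fourierCoeff f n) + C (fourierCoeff f (n - 1)) := by
  unfold fourierCoeff
  rw [← B.integral_comp_comm (hf.fourier_smul _), ← C.integral_comp_comm (hf.fourier_smul _),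
    ← integral_add (B.integrable_comp (hf.fourier_smul _))
      (C.integrable_comp (hf.fourier_smul _))]
  congr 1
  ext t
  rw [smul_add, smul_smul, fourier_neg_mul_fourier_one, map_smul, map_smul]

theorem mulOp_toLp_ae (φ : C(UnitAddCircle, E →L[ℂ] E)) (f : L2Circle E) :
    mulOp (ContinuousMap.toLp ∞ AddCircle.haarAddCircle ℂ φ) f =ᵐ[AddCircle.haarAddCircle]
      fun t => φ t (f t) := by
  have h1 := (ContinuousLinearMap.id ℂ (E →L[ℂ] E)).coeFn_holder (r := 2)
    (ContinuousMap.toLp ∞ AddCircle.haarAddCircle ℂ φ) f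
  have h2 := ContinuousMap.coeFn_toLp (p := ∞) (𝕜 := ℂ) AddCircle.haarAddCircle φ
  filter_upwards [h1, h2] with t ht1 ht2
  refine ht1.trans ?_
  rw [ht2]
  rfl

theorem mulOp_affineSymbol_ae (B C : E →L[ℂ] E) (f : L2Circle E) :
    mulOp (affineSymbol B C) f =ᵐ[AddCircle.haarAddCircle]
      fun t => B (f t) + (fourier 1 t : ℂ) • C (f t) :=
  mulOp_toLp_ae _ f

theorem mulOp_affineSymbol_mem_H2 (B C : E →L[ℂ] E) {f : L2Circle E} (hf : f ∈ H2 E) :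
    mulOp (affineSymbol B C) f ∈ H2 E := by
  intro n hn
  rw [fourierCoeff_congr_ae (mulOp_affineSymbol_ae B C f),
    fourierCoeff_affine B C (integrable_L2Circle f), hf n hn, hf (n - 1) (by linarith), map_zero,
    map_zero, add_zero]

/-- `S` acts on `H²(E)` as multiplication by the operator-valued function `s`. -/
def ActsBy (S : H2 E →L[ℂ] H2 E) (s : UnitAddCircle → E →L[ℂ] E) : Prop :=
  ∀ f : H2 E, ((S f : L2Circle E) : UnitAddCircle → E) =ᵐ[AddCircle.haarAddCircle]
    fun t => s t ((f : L2Circle E) t)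

theorem toeplitz_affineSymbol_actsBy (B C : E →L[ℂ] E) :
    ActsBy (toeplitz (affineSymbol B C)) fun t => B + (fourier 1 t : ℂ) • C := by
  intro f
  have h : ((toeplitz (affineSymbol B C) f : H2 E) : L2Circle E) =
      mulOp (affineSymbol B C) (f : L2Circle E) :=
    Submodule.starProjection_eq_self_iff.2 (mulOp_affineSymbol_mem_H2 B C f.2)
  rw [h]
  exact mulOp_affineSymbol_ae B C f

namespace ActsBy

variable {S S' : H2 E →L[ℂ] H2 E} {s s' : UnitAddCircle → E →L[ℂ] E}

theorem unique (h : ActsBy S s) (h' : ActsBy S' s) : S = S' := by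
  ext1 f
  exact Subtype.ext (Lp.ext ((h f).trans (h' f).symm))

theorem one : ActsBy (1 : H2 E →L[ℂ] H2 E) fun _ => 1 := fun _ => Filter.EventuallyEq.rfl

theorem zero : ActsBy (0 : H2 E →L[ℂ] H2 E) fun _ => 0 := fun _ => Lp.coeFn_zero _ _ _

theorem mul (h : ActsBy S s) (h' : ActsBy S' s') : ActsBy (S * S') fun t => s t * s' t := by
  intro f
  filter_upwards [h (S' f), h' f] with t h1 h2
  refine h1.trans ?_
  rw [h2]
  rfl

theorem add (h : ActsBy S s) (h' : ActsBy S' s') : ActsBy (S + S') fun t => s t + s' t := by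
  intro f
  filter_upwards [h f, h' f, Lp.coeFn_add (S f : L2Circle E) (S' f)] with t h1 h2 h3
  refine h3.trans ?_
  rw [Pi.add_apply, h1, h2]
  rfl

theorem smul (c : ℂ) (h : ActsBy S s) : ActsBy (c • S) fun t => c • s t := by
  intro f
  filter_upwards [h f, Lp.coeFn_smul c (S f : L2Circle E)] with t h1 h2
  refine h2.trans ?_
  rw [Pi.smul_apply, h1]
  rfl

theorem sub (h : ActsBy S s) (h' : ActsBy S' s') : ActsBy (S - S') fun t => s t - s' t := by
  intro f
  filter_upwards [h f, h' f, Lp.coeFn_sub (S f : L2Circle E) (S' f)] with t h1 h2 h3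
  refine h3.trans ?_
  rw [Pi.sub_apply, h1, h2]
  rfl

theorem pow (h : ActsBy S s) (n : ℕ) : ActsBy (S ^ n) fun t => s t ^ n := by
  induction n with
  | zero => simpa using one
  | succ n ih => simpa only [pow_succ] using ih.mul h

theorem sum {ι : Type*} (u : Finset ι) {S : ι → H2 E →L[ℂ] H2 E}
    {s : ι → UnitAddCircle → E →L[ℂ] E} (h : ∀ i, ActsBy (S i) (s i)) :
    ActsBy (∑ i ∈ u, S i) fun t => ∑ i ∈ u, s i t := by
  classical
  induction u using Finset.induction_on with
  | empty => simpa using zero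
  | insert i u hi ih => simpa only [Finset.sum_insert hi] using (h i).add ih

theorem norm_apply_le (h : ActsBy S s) (h' : ActsBy S' s')
    (hle : ∀ t x, ‖s t x‖ ≤ ‖s' t x‖) (f : H2 E) : ‖S f‖ ≤ ‖S' f‖ := by
  refine Lp.norm_le_norm_of_ae_le (f := (S f : L2Circle E)) (g := (S' f : L2Circle E)) ?_
  filter_upwards [h f, h' f] with t h1 h2
  rw [h1, h2]
  exact hle t _

theorem opNorm_le (h : ActsBy S s) {c : ℝ} (hc : 0 ≤ c) (hle : ∀ t, ‖s t‖ ≤ c) : ‖S‖ ≤ c := by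
  refine opNorm_le_bound _ hc fun f => ?_
  refine Lp.norm_le_mul_norm_of_ae_le_mul (f := (S f : L2Circle E)) (g := (f : L2Circle E)) ?_
  filter_upwards [h f] with t h1
  rw [h1]
  exact (s t).le_of_opNorm_le (hle t) _

/-- `S* S'` acts by `r` as soon as `s(t)* s'(t) = r(t)`. -/
theorem adjoint_mul_eq {R : H2 E →L[ℂ] H2 E} {r : UnitAddCircle → E →L[ℂ] E} (h : ActsBy S s)
    (h' : ActsBy S' s') (hR : ActsBy R r) (e : ∀ t, adjoint (s t) * s' t = r t) :
    adjoint S * S' = R := by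
  ext1 f
  -- `S*` need not be a multiplication, only a compression of one; pairing with `g` in `H²` moves it
  -- back to `S`.
  refine ext_inner_left ℂ fun g => ?_
  rw [mul_apply_eq_comp, adjoint_inner_right, Submodule.coe_inner, Submodule.coe_inner,
    L2.inner_def, L2.inner_def]
  refine integral_congr_ae ?_
  filter_upwards [h g, h' f, hR f] with t h1 h2 h3
  rw [h1, h2, h3, ← adjoint_inner_right, ← e]
  rfl

/-- A polynomial in the co-analytic `V i*` need not act pointwise, but its adjoint does: it is the
polynomial in the `V i` with conjugated coefficients. -/
theorem polyEval_adjoint {V : Fin 3 → H2 E →L[ℂ] H2 E} {v : Fin 3 → UnitAddCircle → E →L[ℂ] E}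
    (hV : ∀ i j, Commute (V i) (V j)) (hv : ∀ t i j, Commute (v i t) (v j t))
    (h : ∀ i, ActsBy (V i) (v i)) (p : MvPolynomial (Fin 3) ℂ) :
    ActsBy (adjoint (polyEval p fun i => adjoint (V i)))
      fun t => adjoint (polyEval p fun i => adjoint (v i t)) := by
  have key : ∀ {H : Type _} [NormedAddCommGroup H] [InnerProductSpace ℂ H] [CompleteSpace H]
      (W : Fin 3 → H →L[ℂ] H), (∀ i j, Commute (W i) (W j)) →
      adjoint (polyEval p fun i => adjoint (W i)) =
        ∑ m ∈ p.support, star (p.coeff m) • (W 0 ^ m 0 * W 1 ^ m 1 * W 2 ^ m 2) := by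
    intro H _ _ _ W hW
    rw [← star_eq_adjoint, polyEval, star_sum]
    refine Finset.sum_congr rfl fun m _ => ?_
    simp only [star_smul, star_mul, star_pow, ← star_eq_adjoint, star_star]
    rw [((hW 1 0).pow_pow _ _).eq, ((((hW 0 2).pow_pow _ _)).mul_left ((hW 1 2).pow_pow _ _)).eq]
  rw [key V hV]
  simp only [key _ (hv _)]
  exact sum _ fun m => ((((h 0).pow _).mul ((h 1).pow _)).mul ((h 2).pow _)).smul _

end ActsBy

end HardyCalculus

/-! ### Constant functions and the shift -/

section Constants

variable (E : Type*) [NormedAddCommGroup E] [InnerProductSpace ℂ E] [CompleteSpace E]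

theorem integral_fourier (n : ℤ) :
    ∫ t : UnitAddCircle, (fourier n t : ℂ) ∂AddCircle.haarAddCircle = if n = 0 then 1 else 0 := by
  have h := orthonormal_iff_ite.1 (orthonormal_fourier (T := (1 : ℝ))) 0 n
  rw [ContinuousMap.inner_toLp] at h
  simpa [eq_comm] using h

theorem fourierCoeff_const (x : E) (n : ℤ) :
    fourierCoeff (fun _ : UnitAddCircle => x) n = if n = 0 then x else 0 := by
  unfold fourierCoeff
  rw [integral_smul_const, integral_fourier]
  split_ifs <;> simp_all

/-- The isometric embedding of `E` into `H²(E)` as the space of constant functions. -/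
def constH2 : E →ₗᵢ[ℂ] H2 E where
  toFun x := ⟨Lp.const 2 AddCircle.haarAddCircle x, fun n hn => by
    rw [fourierCoeff_congr_ae (Lp.coeFn_const _ _ _)]
    exact (fourierCoeff_const E x n).trans (if_neg hn.ne)⟩
  map_add' x y := rfl
  map_smul' c x := rfl
  norm_map' x := by
    change ‖Lp.const 2 AddCircle.haarAddCircle x‖ = ‖x‖
    rw [Lp.norm_const _ _ _ two_ne_zero]
    simp

variable {E}

theorem constH2_ae (x : E) : ((constH2 E x : L2Circle E) : UnitAddCircle → E)
    =ᵐ[AddCircle.haarAddCircle] fun _ => x :=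
  Lp.coeFn_const _ _ _

theorem inner_constH2_left (x : E) (f : H2 E) :
    inner ℂ (constH2 E x) f = inner ℂ x (fourierCoeff ((f : L2Circle E) : UnitAddCircle → E) 0) := by
  rw [Submodule.coe_inner, L2.inner_def, fourierCoeff,
    ← integral_inner ((integrable_L2Circle _).fourier_smul _)]
  refine integral_congr_ae ?_
  filter_upwards [constH2_ae x] with t ht
  rw [ht]
  simp

theorem adjoint_constH2_apply (f : H2 E) :
    adjoint (constH2 E).toContinuousLinearMap f =
      fourierCoeff ((f : L2Circle E) : UnitAddCircle → E) 0 := by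
  refine ext_inner_left ℂ fun x => ?_
  rw [adjoint_inner_right]
  exact inner_constH2_left x f

/-- Dually, the zeroth coefficient of `(B + z C) f` is `B` applied to that of `f`, because the
coefficient of index `-1` vanishes. -/
theorem adjoint_toeplitz_affineSymbol_constH2 (B C : E →L[ℂ] E) (x : E) :
    adjoint (toeplitz (affineSymbol B C)) (constH2 E x) = constH2 E (adjoint B x) := by
  refine ext_inner_right ℂ fun f => ?_
  rw [adjoint_inner_left, inner_constH2_left, inner_constH2_left,
    fourierCoeff_congr_ae (toeplitz_affineSymbol_actsBy B C f), adjoint_inner_left]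
  have := fourierCoeff_affine B C (integrable_L2Circle (f : L2Circle E)) 0
  rw [f.2 (0 - 1) (by norm_num), map_zero, add_zero] at this
  rw [← this]
  rfl

/-- Every function in `H²(E)` is the sum of a constant and a multiple of `z`. -/
theorem exists_eq_constH2_add_toeplitz (f : H2 E) :
    ∃ g : H2 E, f = constH2 E (fourierCoeff ((f : L2Circle E) : UnitAddCircle → E) 0) +
      toeplitz (affineSymbol 0 1) g := by
  set h : H2 E := f - constH2 E (fourierCoeff ((f : L2Circle E) : UnitAddCircle → E) 0) with hh
  have h0 : fourierCoeff ((h : L2Circle E) : UnitAddCircle → E) 0 = 0 := by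
    rw [← adjoint_constH2_apply, hh, map_sub, adjoint_constH2_apply, adjoint_constH2_apply,
      fourierCoeff_congr_ae (constH2_ae _), fourierCoeff_const, if_pos rfl, sub_self]
  -- `k = z̄ h` shifts the coefficients of `h` down by one; `h0` covers the index `-1`.
  set k : L2Circle E := mulOp (ContinuousMap.toLp ∞ AddCircle.haarAddCircle ℂ
    ⟨fun t => (fourier (-1) t : ℂ) • (1 : E →L[ℂ] E), by fun_prop⟩) (h : L2Circle E)
  have hk : k =ᵐ[AddCircle.haarAddCircle]
      fun t => (fourier (-1) t : ℂ) • (h : L2Circle E) t := mulOp_toLp_ae _ _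
  have hkmem : k ∈ H2 E := by
    intro n hn
    have e : fourierCoeff (k : UnitAddCircle → E) n =
        fourierCoeff ((h : L2Circle E) : UnitAddCircle → E) (n + 1) := by
      rw [fourierCoeff_congr_ae hk]
      unfold fourierCoeff
      congr 1
      ext t
      rw [smul_smul, ← fourier_add, neg_add]
    rw [e]
    rcases eq_or_lt_of_le (Int.add_one_le_of_lt hn) with h' | h'
    · rw [h', h0]
    · exact h.2 _ h'
  refine ⟨⟨k, hkmem⟩, ?_⟩
  rw [← sub_eq_iff_eq_add', ← hh]
  refine Subtype.ext (Lp.ext ?_)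
  filter_upwards [toeplitz_affineSymbol_actsBy 0 1 ⟨k, hkmem⟩, hk] with t h1 h2
  rw [h1, zero_add, smul_apply, one_apply_eq_self, h2, smul_smul, ← fourier_add]
  simp

theorem adjoint_toeplitz_z_mul_self :
    adjoint (toeplitz (affineSymbol (0 : E →L[ℂ] E) 1)) * toeplitz (affineSymbol 0 1) = 1 := by
  refine (toeplitz_affineSymbol_actsBy 0 1).adjoint_mul_eq (toeplitz_affineSymbol_actsBy 0 1)
    ActsBy.one fun t => ?_
  rw [← star_eq_adjoint, zero_add, star_smul, star_one, smul_mul_smul_comm, star_fourier_one_mul,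
    one_smul, mul_one]

/-- Decomposition `H² = E ⊕ z H²`: `T_z*` kills constants and inverts the shift on its range. -/
theorem constH2_add_toeplitz_z (f : H2 E) :
    constH2 E (adjoint (constH2 E).toContinuousLinearMap f) +
      toeplitz (affineSymbol 0 1) (adjoint (toeplitz (affineSymbol 0 1)) f) = f := by
  obtain ⟨g, hg⟩ := exists_eq_constH2_add_toeplitz f
  rw [← adjoint_constH2_apply] at hg
  set x := adjoint (constH2 E).toContinuousLinearMap f
  have h1 : adjoint (toeplitz (affineSymbol (0 : E →L[ℂ] E) 1))
      (toeplitz (affineSymbol 0 1) g) = g := congr($adjoint_toeplitz_z_mul_self g)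
  have h2 : adjoint (toeplitz (affineSymbol (0 : E →L[ℂ] E) 1)) f = g := by
    rw [hg, map_add, adjoint_toeplitz_affineSymbol_constH2, h1, map_zero, zero_apply, map_zero,
      zero_add]
  rw [h2, ← hg]

end Constants

/-! ### Phase alignment; fundamental operators from an isometry -/

section Auxiliary

theorem exists_norm_add_star_mul_eq (a b : ℂ) :
    ∃ z : ℂ, ‖z‖ = 1 ∧ ‖a + star z * b‖ = ‖a‖ + ‖b‖ := by
  have hu : ‖Complex.exp (a.arg * Complex.I)‖ = 1 := Complex.norm_exp_ofReal_mul_I _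
  have hv : ‖Complex.exp (b.arg * Complex.I)‖ = 1 := Complex.norm_exp_ofReal_mul_I _
  have ha := Complex.norm_mul_exp_arg_mul_I a
  have hb := Complex.norm_mul_exp_arg_mul_I b
  set u := Complex.exp (a.arg * Complex.I)
  set v := Complex.exp (b.arg * Complex.I)
  have hvv : star v * v = 1 := by
    have := Complex.conj_mul' v
    rw [hv] at this
    simpa using this
  -- With `u, v` the phases of `a, b`, this rotates `b` onto the ray of `a`.
  refine ⟨star u * v, by rw [norm_mul, norm_star, hu, hv, one_mul], ?_⟩
  have e : a + star (star u * v) * b = ((‖a‖ + ‖b‖ : ℝ) : ℂ) * u := by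
    rw [star_mul, star_star]
    push_cast
    linear_combination (-1 : ℂ) * ha - star v * u * hb + (‖b‖ : ℂ) * u * hvv
  rw [e, norm_mul, hu, mul_one, Complex.norm_real, Real.norm_of_nonneg (by positivity)]

variable {H : Type*} [NormedAddCommGroup H] [InnerProductSpace ℂ H] [CompleteSpace H]

theorem isUnit_adjoint_of_isUnit {V : Fin 3 → H →L[ℂ] H} {z w : ℂ}
    (h : IsUnit (1 - star z • V 0 - star w • V 1 + (star z * star w) • V 2)) :
    IsUnit (1 - z • adjoint (V 0) - w • adjoint (V 1) + (z * w) • adjoint (V 2)) := by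
  simpa [← star_eq_adjoint, mul_comm] using h.star

variable {E : Type*} [NormedAddCommGroup E] [InnerProductSpace ℂ E] [CompleteSpace E]

theorem adjoint_comp_self_of_linearIsometry_apply (J : E →ₗᵢ[ℂ] H) (x : E) :
    adjoint J.toContinuousLinearMap (J x) = x := by
  refine ext_inner_left ℂ fun y => ?_
  rw [adjoint_inner_right]
  exact J.inner_map_map y x

theorem defectOp_eq_of_linearIsometry (J : E →ₗᵢ[ℂ] H) {T : H →L[ℂ] H}
    (h : 1 - adjoint T * T = J.toContinuousLinearMap ∘L adjoint J.toContinuousLinearMap) :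
    defectOp T = J.toContinuousLinearMap ∘L adjoint J.toContinuousLinearMap := by
  refine CFC.sqrt_unique ?_ ?_
  · rw [h]
    ext1 f
    exact congr(J $(adjoint_comp_self_of_linearIsometry_apply J _))
  · rw [nonneg_iff_isPositive]
    exact isPositive_self_comp_adjoint _

/-- The defect operator is the projection `J J*`, so the defect space is the range of `J`. It acts
there as the identity, so a sandwich determines its middle operator; hence uniqueness. -/
theorem exists_linearIsometryEquiv_defectSpace (J : E →ₗᵢ[ℂ] H) {T : Fin 3 → H →L[ℂ] H}
    {A₁ A₂ : E →L[ℂ] E}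
    (h : 1 - adjoint (T 2) * T 2 = J.toContinuousLinearMap ∘L adjoint J.toContinuousLinearMap)
    (h₁ : T 0 - adjoint (T 1) * T 2 =
      J.toContinuousLinearMap ∘L A₁ ∘L adjoint J.toContinuousLinearMap)
    (h₂ : T 1 - adjoint (T 0) * T 2 =
      J.toContinuousLinearMap ∘L A₂ ∘L adjoint J.toContinuousLinearMap) :
    ∃ U : E ≃ₗᵢ[ℂ] defectSpace (T 2), (∀ x, (U x : H) = J x) ∧
      AreFundamentalOperators T
        ((U : E →L[ℂ] defectSpace (T 2)) ∘L A₁ ∘L (U.symm : defectSpace (T 2) →L[ℂ] E))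
        ((U : E →L[ℂ] defectSpace (T 2)) ∘L A₂ ∘L (U.symm : defectSpace (T 2) →L[ℂ] E)) := by
  have hD := defectOp_eq_of_linearIsometry J h
  have hDJ : ∀ x, defectOp (T 2) (J x) = J x := fun x => by
    rw [hD]
    exact congr(J $(adjoint_comp_self_of_linearIsometry_apply J x))
  have hDf : ∀ f, defectOp (T 2) f = J (adjoint J.toContinuousLinearMap f) := fun f => by
    rw [hD]
    rfl
  have hfix : ∀ y : defectSpace (T 2), defectOp (T 2) y = y := by
    rintro ⟨y, hy⟩
    refine closure_minimal (t := {y | defectOp (T 2) y = y}) ?_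
      (isClosed_eq (defectOp (T 2)).continuous continuous_id) hy
    rintro _ ⟨f, rfl⟩
    change defectOp (T 2) (defectOp (T 2) f) = defectOp (T 2) f
    rw [hDf f, hDJ]
  let J' : E →ₗᵢ[ℂ] defectSpace (T 2) :=
    { toFun := fun x => ⟨J x, hDJ x ▸ defectOp_mem (T 2) (J x)⟩
      map_add' := fun x y => Subtype.ext (J.map_add x y)
      map_smul' := fun c x => Subtype.ext (J.map_smul c x)
      norm_map' := fun x => J.norm_map x }
  let U : E ≃ₗᵢ[ℂ] defectSpace (T 2) := LinearIsometryEquiv.ofSurjective J' fun y =>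
    ⟨adjoint J.toContinuousLinearMap y, Subtype.ext ((hDf y).symm.trans (hfix y))⟩
  have hU : ∀ x, (U x : H) = J x := fun x => rfl
  have hsand : ∀ A : E →L[ℂ] E,
      defectSandwich (T 2)
        ((U : E →L[ℂ] defectSpace (T 2)) ∘L A ∘L (U.symm : defectSpace (T 2) →L[ℂ] E)) =
      J.toContinuousLinearMap ∘L A ∘L adjoint J.toContinuousLinearMap := by
    intro A
    ext1 f
    have e : U.symm ⟨defectOp (T 2) f, defectOp_mem (T 2) f⟩ =
        adjoint J.toContinuousLinearMap f := by
      rw [LinearIsometryEquiv.symm_apply_eq]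
      exact Subtype.ext (hDf f)
    change defectOp (T 2) (J (A (U.symm ⟨defectOp (T 2) f, defectOp_mem (T 2) f⟩))) = _
    rw [e, hDJ]
    rfl
  have hinj : ∀ F G : defectSpace (T 2) →L[ℂ] defectSpace (T 2),
      defectSandwich (T 2) F = defectSandwich (T 2) G → F = G := by
    intro F G hFG
    have key : ∀ (F : defectSpace (T 2) →L[ℂ] defectSpace (T 2)) (y : defectSpace (T 2)),
        defectSandwich (T 2) F y = F y := by
      intro F y
      have e : (⟨defectOp (T 2) y, defectOp_mem (T 2) y⟩ : defectSpace (T 2)) = y :=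
        Subtype.ext (hfix y)
      change defectOp (T 2) (F ⟨defectOp (T 2) y, defectOp_mem (T 2) y⟩) = F y
      rw [e, hfix]
    ext1 y
    exact Subtype.ext (by rw [← key F, ← key G, hFG])
  refine ⟨U, hU, ⟨h₁.trans (hsand A₁).symm, h₂.trans (hsand A₂).symm⟩, ?_⟩
  rintro G₁ G₂ ⟨hG₁, hG₂⟩
  exact ⟨hinj _ _ (hG₁.symm.trans (h₁.trans (hsand A₁).symm)),
    hinj _ _ (hG₂.symm.trans (h₂.trans (hsand A₂).symm))⟩

end Auxiliary

/-! ### The symbols and the `𝔼`-contraction property -/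

section Symbols

variable {E : Type*} [NormedAddCommGroup E] [InnerProductSpace ℂ E] [CompleteSpace E]

/-- The analytic Toeplitz operators `T_{A₁* + A₂ z}`, `T_{A₂* + A₁ z}`, `T_z` on `H²(E)`. -/
def toeplitzTriple (A₁ A₂ : E →L[ℂ] E) : Fin 3 → H2 E →L[ℂ] H2 E :=
  ![toeplitz (affineSymbol (adjoint A₁) A₂), toeplitz (affineSymbol (adjoint A₂) A₁),
    toeplitz (affineSymbol 0 1)]

/-- The symbols of `toeplitzTriple`. -/
def symbolTriple (A₁ A₂ : E →L[ℂ] E) : Fin 3 → UnitAddCircle → E →L[ℂ] E :=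
  ![fun t => adjoint A₁ + (fourier 1 t : ℂ) • A₂, fun t => adjoint A₂ + (fourier 1 t : ℂ) • A₁,
    fun t => 0 + (fourier 1 t : ℂ) • 1]

theorem adjointToeplitzTriple_eq (A₁ A₂ : E →L[ℂ] E) :
    adjointToeplitzTriple A₁ A₂ = fun i => adjoint (toeplitzTriple A₁ A₂ i) := by
  ext1 i
  fin_cases i <;> rfl

theorem toeplitzTriple_actsBy (A₁ A₂ : E →L[ℂ] E) (i : Fin 3) :
    ActsBy (toeplitzTriple A₁ A₂ i) (symbolTriple A₁ A₂ i) := by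
  fin_cases i <;> exact toeplitz_affineSymbol_actsBy _ _

variable {A₁ A₂ : E →L[ℂ] E}

theorem adjoint_symbolTriple_zero_mul (t : UnitAddCircle) :
    adjoint (symbolTriple A₁ A₂ 0 t) * symbolTriple A₁ A₂ 2 t = symbolTriple A₁ A₂ 1 t := by
  simp only [symbolTriple, Matrix.cons_val, ← star_eq_adjoint, star_add, star_smul, star_star,
    zero_add, mul_smul_comm, mul_one, smul_add, smul_smul]
  rw [mul_comm, star_fourier_one_mul, one_smul, add_comm]

theorem symbolTriple_one (t : UnitAddCircle) :
    symbolTriple A₁ A₂ 1 t = (fourier 1 t : ℂ) • star (symbolTriple A₁ A₂ 0 t) := by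
  rw [← adjoint_symbolTriple_zero_mul, ← star_eq_adjoint]
  simp only [symbolTriple, Matrix.cons_val, zero_add, mul_smul_comm, mul_one]

theorem symbolTriple_two (t : UnitAddCircle) :
    symbolTriple A₁ A₂ 2 t = (fourier 1 t : ℂ) • 1 :=
  zero_add _

/-- In `N N* = N* N` the coefficients of `z` and `z̄` agree by commutativity, the constant terms by
the self-commutator identity. -/
theorem isStarNormal_symbolTriple_zero (hcomm : Commute A₁ A₂)
    (hself : adjoint A₁ * A₁ - A₁ * adjoint A₁ = adjoint A₂ * A₂ - A₂ * adjoint A₂)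
    (t : UnitAddCircle) : IsStarNormal (symbolTriple A₁ A₂ 0 t) := by
  constructor
  have h1 : star A₁ * star A₂ = star A₂ * star A₁ := by
    rw [← star_mul, ← star_mul, hcomm.eq]
  have h2 : A₁ * star A₁ + star A₂ * A₂ = star A₁ * A₁ + A₂ * star A₂ := by
    simp only [← star_eq_adjoint, sub_eq_sub_iff_add_eq_add] at hself
    rw [add_comm, ← hself]
  change star (adjoint A₁ + (fourier 1 t : ℂ) • A₂) * (adjoint A₁ + (fourier 1 t : ℂ) • A₂) =
    (adjoint A₁ + (fourier 1 t : ℂ) • A₂) * star (adjoint A₁ + (fourier 1 t : ℂ) • A₂)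
  have h3 : (fourier 1 t : ℂ) * star (fourier 1 t : ℂ) = 1 := by
    rw [mul_comm, star_fourier_one_mul]
  simp only [← star_eq_adjoint, star_add, star_star, star_smul, add_mul, mul_add, smul_mul_assoc,
    mul_smul_comm, hcomm.eq, h1]
  linear_combination (norm := module) h2 + h3 • (star A₂ * A₂ - A₂ * star A₂)

theorem commute_symbolTriple (h : ∀ t, IsStarNormal (symbolTriple A₁ A₂ 0 t)) (t : UnitAddCircle)
    (i j : Fin 3) : Commute (symbolTriple A₁ A₂ i t) (symbolTriple A₁ A₂ j t) := by
  have h2 : ∀ S, Commute (symbolTriple A₁ A₂ 2 t) S := fun S => by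
    rw [symbolTriple_two]
    exact (Commute.one_left _).smul_left _
  have h1 : Commute (symbolTriple A₁ A₂ 0 t) (symbolTriple A₁ A₂ 1 t) := by
    rw [symbolTriple_one]
    exact (h t).star_comm_self.symm.smul_right _
  fin_cases i <;> fin_cases j
  exacts [Commute.refl _, h1, (h2 _).symm, h1.symm, Commute.refl _, (h2 _).symm, h2 _, h2 _, h2 _]

theorem commute_toeplitzTriple (h : ∀ t, IsStarNormal (symbolTriple A₁ A₂ 0 t)) (i j : Fin 3) :
    Commute (toeplitzTriple A₁ A₂ i) (toeplitzTriple A₁ A₂ j) := by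
  have hij := (toeplitzTriple_actsBy A₁ A₂ i).mul (toeplitzTriple_actsBy A₁ A₂ j)
  simp only [(commute_symbolTriple h _ i j).eq] at hij
  exact hij.unique ((toeplitzTriple_actsBy A₁ A₂ j).mul (toeplitzTriple_actsBy A₁ A₂ i))

theorem norm_symbolTriple_zero_le (h : ∀ t, IsStarNormal (symbolTriple A₁ A₂ 0 t))
    (hω : ∀ z : ℂ, ‖z‖ = 1 → numericalRadius (A₁ + z • A₂) ≤ 1) (t : UnitAddCircle) :
    ‖symbolTriple A₁ A₂ 0 t‖ ≤ 1 := by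
  have := h t
  refine norm_le_of_norm_inner_le zero_le_one fun x => ?_
  set a := inner ℂ (A₁ x) x with ha
  set b := inner ℂ (A₂ x) x with hb
  have hab : ‖a‖ + ‖b‖ ≤ 1 * ‖x‖ ^ 2 := by
    obtain ⟨z, hz, hzab⟩ : ∃ z : ℂ, ‖z‖ = 1 ∧ ‖a + star z * b‖ = ‖a‖ + ‖b‖ := by
      exact exists_norm_add_star_mul_eq a b
    have := norm_inner_le_of_numericalRadius_le (hω z hz) x
    rw [add_apply, smul_apply, inner_add_left, inner_smul_left] at this
    rw [← hzab]
    exact this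
  refine le_trans ?_ hab
  have e : inner ℂ (symbolTriple A₁ A₂ 0 t x) x = star a + star (fourier 1 t : ℂ) * b := by
    change inner ℂ (adjoint A₁ x + (fourier 1 t : ℂ) • A₂ x) x = _
    rw [inner_add_left, inner_smul_left, adjoint_inner_left, ha]
    congr 1
    exact (inner_conj_symm _ _).symm
  rw [e]
  refine (norm_add_le _ _).trans_eq ?_
  rw [norm_mul, norm_star, norm_star, norm_fourier_apply, one_mul]

theorem isEContraction_adjointToeplitzTriple (hn : ∀ t, IsStarNormal (symbolTriple A₁ A₂ 0 t))
    (hle : ∀ t, ‖symbolTriple A₁ A₂ 0 t‖ ≤ 1) :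
    IsEContraction (adjointToeplitzTriple A₁ A₂) := by
  have hc : ∀ i j, Commute (adjointToeplitzTriple A₁ A₂ i) (adjointToeplitzTriple A₁ A₂ j) := by
    intro i j
    rw [adjointToeplitzTriple_eq]
    exact (commute_toeplitzTriple hn i j).star_star
  have hV := toeplitzTriple_actsBy A₁ A₂
  refine ⟨hc, taylorSpectrum_subset_closure_tetrablock hc fun z w hz hw => ?_, fun p => ?_⟩
  -- Invertibility is proved for the analytic triple at conjugate parameters, where pointwise
  -- estimates apply, then adjoints are taken.
  · have hu : IsUnit (1 - star z • toeplitzTriple A₁ A₂ 0 - star w • toeplitzTriple A₁ A₂ 1 +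
        (star z * star w) • toeplitzTriple A₁ A₂ 2) := by
      refine isUnit_one_sub_sub_add ((hV 0).opNorm_le zero_le_one hle) (fun z f hz => ?_)
        (by rwa [norm_star]) (by rwa [norm_star])
      refine ((hV 1).sub ((hV 2).smul z)).norm_apply_le (ActsBy.one.sub ((hV 0).smul z))
        (fun t x => ?_) f
      have := hn t
      refine le_trans (le_of_eq ?_) (norm_adjoint_sub_smul_le (hle t) hz.le x)
      rw [symbolTriple_one, symbolTriple_two, smul_comm z, ← smul_sub, smul_apply, norm_smul,
        norm_fourier_apply, one_mul]
      rfl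
    rw [adjointToeplitzTriple_eq]
    exact isUnit_adjoint_of_isUnit hu
  -- An infinite supremum is trivial, so boundedness of the tetrablock is not needed.
  · rcases eq_or_ne (⨆ x ∈ closure tetrablock, ‖MvPolynomial.eval x p‖ₑ) ⊤ with htop | htop
    · rw [htop]
      exact le_top
    set c := (⨆ x ∈ closure tetrablock, ‖MvPolynomial.eval x p‖ₑ).toReal with hcdef
    have hp : ∀ x ∈ closure tetrablock, ‖MvPolynomial.eval x p‖ ≤ c := by
      intro x hx
      rw [← toReal_enorm]
      exact ENNReal.toReal_mono htop (le_iSup₂ (f := fun x (_ : x ∈ closure tetrablock) =>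
        ‖MvPolynomial.eval x p‖ₑ) x hx)
    rw [← ENNReal.ofReal_toReal htop, ← ofReal_norm, ← hcdef]
    refine ENNReal.ofReal_le_ofReal ?_
    rw [adjointToeplitzTriple_eq, ← LinearIsometryEquiv.norm_map adjoint]
    refine (ActsBy.polyEval_adjoint (commute_toeplitzTriple hn) (commute_symbolTriple hn) hV
      p).opNorm_le ENNReal.toReal_nonneg fun t => ?_
    rw [LinearIsometryEquiv.norm_map]
    have := hn t
    -- The adjoint symbols again have the form `(M, ζ M*, ζ)`, with `M = N*` and `ζ = z̄`.
    have e : (fun i => adjoint (symbolTriple A₁ A₂ i t)) =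
        ![star (symbolTriple A₁ A₂ 0 t),
          star (fourier 1 t : ℂ) • star (star (symbolTriple A₁ A₂ 0 t)),
          star (fourier 1 t : ℂ) • 1] := by
      ext1 i
      fin_cases i
      · rfl
      · change star (symbolTriple A₁ A₂ 1 t) = _
        rw [symbolTriple_one, star_smul]
        rfl
      · change star (symbolTriple A₁ A₂ 2 t) = _
        rw [symbolTriple_two, star_smul, star_one]
        rfl
    rw [e]
    exact norm_polyEval_le (by rw [norm_star]; exact hle t)
      (by rw [norm_star, norm_fourier_apply]) ENNReal.toReal_nonneg hp

end Symbols

/-! ### The fundamental equations -/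

section Fundamental

variable {E : Type*} [NormedAddCommGroup E] [InnerProductSpace ℂ E] [CompleteSpace E]

theorem adjoint_toeplitz_mul_toeplitz_z (B C : E →L[ℂ] E) :
    adjoint (toeplitz (affineSymbol (adjoint B) C)) * toeplitz (affineSymbol 0 1) =
      toeplitz (affineSymbol (adjoint C) B) :=
  (toeplitz_affineSymbol_actsBy _ _).adjoint_mul_eq (toeplitz_affineSymbol_actsBy _ _)
    (toeplitz_affineSymbol_actsBy _ _) fun t => adjoint_symbolTriple_zero_mul (A₁ := B) (A₂ := C) t

theorem one_sub_toeplitz_z_mul_adjoint :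
    1 - toeplitz (affineSymbol (0 : E →L[ℂ] E) 1) * adjoint (toeplitz (affineSymbol 0 1)) =
      (constH2 E).toContinuousLinearMap ∘L adjoint (constH2 E).toContinuousLinearMap := by
  ext1 f
  exact sub_eq_of_eq_add (constH2_add_toeplitz_z f).symm

/-- Split `f = J x + T_z g` with `g = T_z* f`: the `T_z g` part cancels the subtracted term, and the
constant part becomes `J (B x)`. -/
theorem adjoint_toeplitz_sub_toeplitz_mul (B C : E →L[ℂ] E) :
    adjoint (toeplitz (affineSymbol (adjoint B) C)) -
        toeplitz (affineSymbol (adjoint C) B) * adjoint (toeplitz (affineSymbol 0 1)) =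
      (constH2 E).toContinuousLinearMap ∘L B ∘L
        adjoint (constH2 E).toContinuousLinearMap := by
  ext1 f
  set x := adjoint (constH2 E).toContinuousLinearMap f with hx
  set g := adjoint (toeplitz (affineSymbol (0 : E →L[ℂ] E) 1)) f with hg
  change adjoint (toeplitz (affineSymbol (adjoint B) C)) f -
    toeplitz (affineSymbol (adjoint C) B) g = constH2 E (B x)
  have h1 : adjoint (toeplitz (affineSymbol (adjoint B) C)) (toeplitz (affineSymbol 0 1) g) =
      toeplitz (affineSymbol (adjoint C) B) g :=
    congr($(adjoint_toeplitz_mul_toeplitz_z B C) g)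
  rw [← constH2_add_toeplitz_z f, ← hx, ← hg, map_add, adjoint_toeplitz_affineSymbol_constH2,
    adjoint_adjoint, h1, add_sub_cancel_right]

end Fundamental

end

theorem corollary3p6 {E : Type*} [NormedAddCommGroup E] [InnerProductSpace ℂ E] [CompleteSpace E]
    (A₁ A₂ : E →L[ℂ] E) (hcomm : Commute A₁ A₂)
    (hself : adjoint A₁ * A₁ - A₁ * adjoint A₁ = adjoint A₂ * A₂ - A₂ * adjoint A₂)
    (hω : ∀ z : ℂ, ‖z‖ = 1 → numericalRadius (A₁ + z • A₂) ≤ 1) :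
    IsEContraction (adjointToeplitzTriple A₁ A₂) ∧
    -- `U` identifies `E` with the defect space, sending a vector to the constant function
    ∃ U : E ≃ₗᵢ[ℂ] defectSpace (adjointToeplitzTriple A₁ A₂ 2),
      (∀ x : E, ((U x : H2 E) : L2Circle E) = Lp.const 2 AddCircle.haarAddCircle x) ∧
      AreFundamentalOperators (adjointToeplitzTriple A₁ A₂)
        ((U : E →L[ℂ] defectSpace (adjointToeplitzTriple A₁ A₂ 2)) ∘L A₁ ∘L
          (U.symm : defectSpace (adjointToeplitzTriple A₁ A₂ 2) →L[ℂ] E))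
        ((U : E →L[ℂ] defectSpace (adjointToeplitzTriple A₁ A₂ 2)) ∘L A₂ ∘L
          (U.symm : defectSpace (adjointToeplitzTriple A₁ A₂ 2) →L[ℂ] E)) := by
  have hn := isStarNormal_symbolTriple_zero hcomm hself
  refine ⟨isEContraction_adjointToeplitzTriple hn (norm_symbolTriple_zero_le hn hω), ?_⟩
  obtain ⟨U, hU, hF⟩ := exists_linearIsometryEquiv_defectSpace (constH2 E)
    (T := adjointToeplitzTriple A₁ A₂) (A₁ := A₁) (A₂ := A₂)
    (by simpa only [adjointToeplitzTriple, Matrix.cons_val, adjoint_adjoint] using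
      one_sub_toeplitz_z_mul_adjoint)
    (by simpa only [adjointToeplitzTriple, Matrix.cons_val, adjoint_adjoint] using
      adjoint_toeplitz_sub_toeplitz_mul A₁ A₂)
    (by simpa only [adjointToeplitzTriple, Matrix.cons_val, adjoint_adjoint] using
      adjoint_toeplitz_sub_toeplitz_mul A₂ A₁)
  exact ⟨U, fun x => congrArg Subtype.val (hU x), hF⟩
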